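/- Call a function $f:(0,+\infty)\to(0,+\infty)$ increasing if $f(s)\le f(t)$ whenever $0<s\le t$. Let $\alpha:(0,+\infty)\to(0,+\infty)$ be an increasing function such that $\int_1^{+\infty}\frac{\alpha(t)}{t^2}\,dt<+\infty$. Then the following conditions are equivalent: (i) $\alpha$ does not satisfy the mild strong non-quasianalyticity condition, which requires that $\int_1^{+\infty}\frac{\alpha(t)}{t^2}\,dt<+\infty$ and $\int_1^{+\infty}\frac{\alpha(t)}{t^2}\ln\frac{t}{\alpha(t)}\,dt<+\infty$; that is, $$\int_1^{+\infty}\frac{\alpha(t)}{t^2}\ln\frac{t}{\alpha(t)}\,dt=+\infty .$$ (ii) For every increasing function $\beta:(0,+\infty)\to(0,+\infty)$ such that $\int_1^{+\infty}\frac{\beta(t)}{t^2}\,dt<+\infty$, we have $$\int_1^{+\infty}\frac{\alpha(t)}{t^2}\ln\frac{t}{\beta(t)}\,dt=+\infty .$$ These two conditions imply the condition (iii) $\displaystyle\int_e^{+\infty}\frac{\alpha(t)}{t^2}\ln\ln t\,dt=+\infty .$ Moreover, all three conditions are equivalent if, in addition, either $\alpha$ is subadditive, i.e. $\alpha(t_1+t_2)\le\alpha(t_1)+\alpha(t_2)$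 for all $t_1,t_2>0$, or $\alpha(t)=\ln|\omega(t)|$ for all $t>0$, for some $\omega\in\mathbf{\Omega}_0$. Here $\mathbf{\Omega}_0$ denotes the set of all entire functions of the form $$\omega(z)=\prod_{j=1}^{\infty}\Big(1+\frac{iz}{t_j}\Big),\quad z\in\mathbb{C},$$ where $0<t_1\le\frac{t_2}{2}\le\frac{t_3}{3}\le\dots\le+\infty$, $t_1<+\infty$ and $\sum_{j=1}^{\infty}\frac1{t_j}<+\infty$ (with $\frac{1}{+\infty}=0$). The integrals in (i)–(iii) with value $+\infty$ are improper integrals: the integrand is integrable on each bounded interval $[a,R]$, where $a$ is the lower limit, and its integral over $[a,R]$ tends to $+\infty$ as $R\to+\infty$. -/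

import Mathlib

open MeasureTheory Set Filter Topology

/-- `f` restricted to `(0, +∞)` takes values in `(0, +∞)` and is increasing, i.e. non-decreasing
(not necessarily strictly). The values of `f` outside `(0, +∞)` are irrelevant. -/
def IsPosIncreasing (f : ℝ → ℝ) : Prop :=
  (∀ t, 0 < t → 0 < f t) ∧ MonotoneOn f (Ioi 0)

/-- The non-quasianalyticity condition `∫_1^{+∞} f(t) / t² dt < +∞`
(for `f` measurable and positive, integrability is finiteness of the integral). -/
def NonQuasianalytic (f : ℝ → ℝ) : Prop :=
  IntegrableOn (fun t => f t / t ^ 2) (Ioi 1)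

/-- The improper integral `∫_a^{+∞} g(t) dt` is equal to `+∞`: the function `g` is integrable on
every `[a, R]`, and `∫_a^R g(t) dt → +∞` as `R → +∞`. -/
def ImproperIntegralEqTop (a : ℝ) (g : ℝ → ℝ) : Prop :=
  (∀ R, a ≤ R → IntervalIntegrable g volume a R) ∧
    Tendsto (fun R => ∫ t in a..R, g t) atTop atTop

/-- The mild strong non-quasianalyticity condition: both integrals
`∫_1^{+∞} f(t) / t² dt` and `∫_1^{+∞} (f(t) / t²) ln (t / f(t)) dt` are finite.
(For an increasing `f` satisfying the first condition, the second integrand is bounded on bounded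
subintervals and eventually positive, so finiteness of its integral is integrability.) -/
def MildStrongNonQuasianalytic (f : ℝ → ℝ) : Prop :=
  NonQuasianalytic f ∧
    IntegrableOn (fun t => f t / t ^ 2 * Real.log (t / f t)) (Ioi 1)

/-- `f(t₁ + t₂) ≤ f(t₁) + f(t₂)` for all `t₁, t₂ > 0`. -/
def IsSubadditiveOnPos (f : ℝ → ℝ) : Prop :=
  ∀ t₁ t₂, 0 < t₁ → 0 < t₂ → f (t₁ + t₂) ≤ f t₁ + f t₂

/-- The set `Ω₀` of all functions `ω(z) = ∏_{j ≥ 1} (1 + i z / t_j)`, `z ∈ ℂ`, where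
`0 < t₁ ≤ t₂ / 2 ≤ t₃ / 3 ≤ ... ≤ +∞`, `t₁ < +∞`, `∑_{j ≥ 1} 1 / t_j < +∞`.
Here `t_j` is written `t (j - 1)`; the value `t_j = +∞` is allowed for `j > 1` and gives
the factor `1`. Such functions are automatically entire. -/
def OmegaZero : Set (ℂ → ℂ) :=
  {w | ∃ t : ℕ → ENNReal, 0 < t 0 ∧ t 0 < ⊤ ∧
    Monotone (fun j : ℕ => t j / ((j : ENNReal) + 1)) ∧
    (∑' j, (t j)⁻¹) < ⊤ ∧
    ∀ z : ℂ, HasProd (fun j => 1 + Complex.I * z * (((t j)⁻¹.toReal : ℝ) : ℂ)) (w z)}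

/-! All the integrands are eventually nonnegative, so divergence to `+∞` is the same as
non-integrability, and the theorem reduces to pointwise comparisons. From `ln x ≤ x` with `x = b/a`
comes `a ln(t/a) ≤ a ln(t/b) + b` (`mul_log_div_le`). With `b = β(t)` this gives (i) ⇒ (ii); the
converse is `β = α`. With `b = t / ln² t` one has `ln(t/b) = 2 ln ln t` and `∫ b/t² < ∞`, which
gives (i) ⇒ (iii). For (iii) ⇒ (i), both special cases provide `α(ks) ≤ C k α(s)` for large `s` and
integers `k ≥ 1`. Then `α(s)/s²` is at least a multiple of `α(t)/(ts)` for `s ≤ t`, and integrating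
in `s` yields `α(t) = O(t / ln t)` (`le_div_log`). Hence `ln ln t ≤ ln(t/α(t)) + O(1)`.
Subadditivity gives `C = 1`, canonical products `C = 5` (`hasSum_log_one_add_sq_nat_mul_le`). -/

/-! ### Divergence and comparison of eventually nonnegative integrals -/

lemma ImproperIntegralEqTop.iff_not_integrableOn {a T : ℝ} {g : ℝ → ℝ}
    (hg : ∀ R, a ≤ R → IntervalIntegrable g volume a R) (hT : a ≤ T)
    (h0 : ∀ t, T ≤ t → 0 ≤ g t) :
    ImproperIntegralEqTop a g ↔ ¬ IntegrableOn g (Ioi a) := by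
  have hI : ∀ R, T ≤ R → IntervalIntegrable g volume T R := fun R hR =>
    (hg T hT).symm.trans (hg R (hT.trans hR))
  have hadd : ∀ R, T ≤ R → (∫ t in a..R, g t) = (∫ t in a..T, g t) + ∫ t in T..R, g t :=
    fun R hR => (intervalIntegral.integral_add_adjacent_intervals (hg T hT) (hI R hR)).symm
  constructor
  · rintro ⟨-, h⟩ hint
    exact not_tendsto_nhds_of_tendsto_atTop h _
      (intervalIntegral_tendsto_integral_Ioi a hint tendsto_id)
  · intro hn
    refine ⟨hg, tendsto_atTop.2 fun b => ?_⟩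
    by_contra hb
    have hmono : ∀ R S, T ≤ R → R ≤ S → (∫ t in a..R, g t) ≤ ∫ t in a..S, g t := by
      intro R S hR hS
      have hRS : IntervalIntegrable g volume R S := (hI R hR).symm.trans (hI S (hR.trans hS))
      rw [← intervalIntegral.integral_add_adjacent_intervals (hg R (hT.trans hR)) hRS]
      have := intervalIntegral.integral_nonneg (μ := volume) hS
        (fun t ht => h0 t (hR.trans ht.1))
      linarith
    have hbd : ∀ R, T ≤ R → (∫ t in a..R, g t) ≤ b := by
      intro R hR
      by_contra hlt
      push Not at hlt
      exact hb (eventually_atTop.2 ⟨R, fun S hS => hlt.le.trans (hmono R S hR hS)⟩)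
    apply hn
    have h1 : IntegrableOn g (Ioi T) := by
      refine integrableOn_Ioi_of_intervalIntegral_norm_bounded (l := atTop) (b := id)
        (b - ∫ t in a..T, g t) T ?_ tendsto_id ?_
      · intro R
        rcases le_total T R with h | h
        · exact (intervalIntegrable_iff_integrableOn_Ioc_of_le h).1 (hI R h)
        · simp [Ioc_eq_empty_of_le h]
      · filter_upwards [eventually_ge_atTop T] with R hR
        have : (∫ t in T..id R, ‖g t‖) = ∫ t in T..R, g t := by
          refine intervalIntegral.integral_congr fun t ht => ?_
          rw [id, uIcc_of_le hR] at ht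
          exact Real.norm_of_nonneg (h0 t ht.1)
        rw [this]
        linarith [hbd R hR, hadd R hR]
    rw [← Ioc_union_Ioi_eq_Ioi hT]
    exact ((intervalIntegrable_iff_integrableOn_Ioc_of_le hT).1 (hg T hT)).union h1

/-- Otherwise the integrals of `f` would tend to `+∞` while staying below convergent ones. -/
lemma integrableOn_Ioi_of_eventually_le {a T : ℝ} {f G : ℝ → ℝ}
    (hf : ∀ R, a ≤ R → IntervalIntegrable f volume a R) (hT : a ≤ T)
    (h : ∀ t, T ≤ t → 0 ≤ f t ∧ f t ≤ G t) (hG : IntegrableOn G (Ioi T)) :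
    IntegrableOn f (Ioi a) := by
  by_contra hn
  have h1 := ((ImproperIntegralEqTop.iff_not_integrableOn hf hT fun t ht => (h t ht).1).2 hn).2
  have h2 := intervalIntegral_tendsto_integral_Ioi T hG tendsto_id
  refine not_tendsto_nhds_of_tendsto_atTop (tendsto_atTop_mono' atTop ?_ h1) _
    (h2.const_add (∫ t in a..T, f t))
  filter_upwards [eventually_ge_atTop T] with R hR
  have hTR : IntervalIntegrable f volume T R := (hf T hT).symm.trans (hf R (hT.trans hR))
  rw [← intervalIntegral.integral_add_adjacent_intervals (hf T hT) hTR]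
  have hGR : IntervalIntegrable G volume T R :=
    (intervalIntegrable_iff_integrableOn_Ioc_of_le hR).2 (hG.mono_set Ioc_subset_Ioi_self)
  have := intervalIntegral.integral_mono_on hR hTR hGR (fun t ht => (h t ht.1).2)
  simpa using this

/-! ### Local integrability and growth of increasing functions -/

lemma IsPosIncreasing.monotoneOn_uIcc {α : ℝ → ℝ} (hα : IsPosIncreasing α) {a R : ℝ}
    (ha : 0 < a) (hR : a ≤ R) : MonotoneOn α (uIcc a R) :=
  hα.2.mono fun t ht => by
    rw [uIcc_of_le hR] at ht
    exact ha.trans_le ht.1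

lemma IsPosIncreasing.intervalIntegrable_div_sq_mul {α h : ℝ → ℝ} (hα : IsPosIncreasing α)
    {a R : ℝ} (ha : 0 < a) (hR : a ≤ R) (hh : ContinuousOn h (uIcc a R)) :
    IntervalIntegrable (fun t => α t / t ^ 2 * h t) volume a R := by
  have h1 := (hα.monotoneOn_uIcc ha hR).intervalIntegrable (μ := volume)
  have h2 : ContinuousOn (fun t : ℝ => (t ^ 2)⁻¹ * h t) (uIcc a R) := by
    refine ContinuousOn.mul (ContinuousOn.inv₀ (by fun_prop) fun t ht => ?_) hh
    rw [uIcc_of_le hR] at ht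
    have := ha.trans_le ht.1
    positivity
  refine (h1.mul_continuousOn h2).congr fun t _ => ?_
  simp only [div_eq_mul_inv, mul_assoc]

lemma IsPosIncreasing.intervalIntegrable_log_div {α β : ℝ → ℝ} (hα : IsPosIncreasing α)
    (hβ : IsPosIncreasing β) {R : ℝ} (hR : 1 ≤ R) :
    IntervalIntegrable (fun t => α t / t ^ 2 * Real.log (t / β t)) volume 1 R := by
  have hsub : ∀ t ∈ uIcc 1 R, 1 ≤ t := fun t ht => by
    rw [uIcc_of_le hR] at ht
    exact ht.1
  have hlog : ContinuousOn Real.log (uIcc 1 R) := fun t ht =>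
    (Real.continuousAt_log (by linarith [hsub t ht])).continuousWithinAt
  have h1 := hα.intervalIntegrable_div_sq_mul one_pos hR
    (hlog.sub (continuousOn_const (c := Real.log (β 1))))
  -- Subtracting `ln β(1)` makes the logarithmic factor nonnegative on `[1, R]`, so its product with
  -- `α` is monotone and therefore integrable.
  have hmono : MonotoneOn (fun t => α t * (Real.log (β t) - Real.log (β 1))) (uIcc 1 R) := by
    have hlogβ : ∀ s t, 1 ≤ s → s ≤ t → Real.log (β s) ≤ Real.log (β t) := fun s t hs hst =>
      Real.log_le_log (hβ.1 s (by linarith))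
        (hβ.2 (by simp only [mem_Ioi]; linarith) (by simp only [mem_Ioi]; linarith) hst)
    intro s hs t ht hst
    have hs1 := hsub s hs
    have := hlogβ s t hs1 hst
    have := hlogβ 1 s le_rfl hs1
    exact mul_le_mul (hα.monotoneOn_uIcc one_pos hR hs ht hst) (by linarith) (by linarith)
      (hα.1 t (by linarith)).le
  have hc : ContinuousOn (fun t : ℝ => (t ^ 2)⁻¹) (uIcc 1 R) :=
    ContinuousOn.inv₀ (by fun_prop) fun t ht => by
      have := hsub t ht
      positivity
  refine (h1.sub (hmono.intervalIntegrable.mul_continuousOn hc)).congr fun t ht => ?_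
  have ht1 : 1 ≤ t := hsub t (uIoc_subset_uIcc ht)
  have := hβ.1 t (by linarith)
  simp only [Pi.sub_apply]
  rw [Real.log_div (by linarith) this.ne']
  ring

lemma IsPosIncreasing.intervalIntegrable_log_log {α : ℝ → ℝ} (hα : IsPosIncreasing α) {R : ℝ}
    (hR : Real.exp 1 ≤ R) :
    IntervalIntegrable (fun t => α t / t ^ 2 * Real.log (Real.log t)) volume (Real.exp 1) R := by
  refine hα.intervalIntegrable_div_sq_mul (Real.exp_pos 1) hR fun t ht => ?_
  rw [uIcc_of_le hR] at ht
  have h0 : 0 < t := (Real.exp_pos 1).trans_le ht.1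
  have h1 : 1 ≤ Real.log t := (Real.le_log_iff_exp_le h0).2 ht.1
  exact ((Real.continuousAt_log h0.ne').log (by linarith)).continuousWithinAt

/-- The integral of `β(s)/s²` over `[t, 2t]` tends to 0, and by monotonicity it is at least `t ·
β(t)/(4t²)`; hence the threshold `1/4`. -/
lemma IsPosIncreasing.eventually_le_self {β : ℝ → ℝ} (hβ : IsPosIncreasing β)
    (hnq : NonQuasianalytic β) : ∃ T, 1 ≤ T ∧ ∀ t, T ≤ t → β t ≤ t := by
  have h1 := intervalIntegral_tendsto_integral_Ioi 1 hnq tendsto_id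
  have h2 := intervalIntegral_tendsto_integral_Ioi 1 hnq
    (tendsto_id.const_mul_atTop (two_pos : (0 : ℝ) < 2))
  have h3 := h2.sub h1
  rw [sub_self] at h3
  obtain ⟨T, hT⟩ := eventually_atTop.1 (h3.eventually_lt_const (show (0 : ℝ) < 1 / 4 by norm_num))
  refine ⟨max T 1, le_max_right _ _, fun t ht => ?_⟩
  have ht1 : 1 ≤ t := (le_max_right _ _).trans ht
  have hi : ∀ a b, 1 ≤ a → a ≤ b → IntervalIntegrable (fun t => β t / t ^ 2) volume a b :=
    fun a b ha hab => (intervalIntegrable_iff_integrableOn_Ioc_of_le hab).2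
      (hnq.mono_set fun x hx => ha.trans_lt hx.1)
  have h4 := hT t ((le_max_left _ _).trans ht)
  simp only [id] at h4
  rw [intervalIntegral.integral_interval_sub_left (hi 1 _ le_rfl (by linarith))
    (hi 1 _ le_rfl ht1)] at h4
  have h5 : (∫ _ in t..2 * t, β t / (4 * t ^ 2)) ≤ ∫ s in t..2 * t, β s / s ^ 2 := by
    refine intervalIntegral.integral_mono_on (by linarith) (by simp) (hi _ _ ht1 (by linarith))
      fun s hs => ?_
    have hs0 : 0 < s := by linarith [hs.1]
    have := hβ.2 (show t ∈ Ioi 0 by simp only [mem_Ioi]; linarith) hs0 hs.1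
    have hpos := hβ.1 s hs0
    refine div_le_div₀ hpos.le this (by positivity) ?_
    nlinarith [hs.1, hs.2]
  rw [intervalIntegral.integral_const, smul_eq_mul] at h5
  have h6 : (2 * t - t) * (β t / (4 * t ^ 2)) = β t / t / 4 := by
    field_simp
    ring
  have h7 : β t / t < 1 := by linarith
  rw [div_lt_one (by linarith)] at h7
  exact h7.le

/-! ### The comparison inequality -/

lemma mul_log_div_le {a b t : ℝ} (ha : 0 < a) (hb : 0 < b) (ht : 0 < t) :
    a * Real.log (t / a) ≤ a * Real.log (t / b) + b := by
  have h1 : Real.log (b / a) ≤ b / a := Real.log_le_self (by positivity)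
  have h2 : a * Real.log (b / a) ≤ b := by
    calc a * Real.log (b / a) ≤ a * (b / a) := by gcongr
      _ = b := by field_simp
  rw [Real.log_div hb.ne' ha.ne'] at h2
  rw [Real.log_div ht.ne' ha.ne', Real.log_div ht.ne' hb.ne']
  linarith

lemma div_sq_mul_log_div_le {a b t : ℝ} (ha : 0 < a) (hb : 0 < b) (ht : 0 < t) :
    a / t ^ 2 * Real.log (t / a) ≤ a / t ^ 2 * Real.log (t / b) + b / t ^ 2 := by
  have := div_le_div_of_nonneg_right (mul_log_div_le ha hb ht) (sq_nonneg t)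
  calc _ = a * Real.log (t / a) / t ^ 2 := by ring
    _ ≤ _ := this
    _ = _ := by ring

lemma div_sq_mul_log_div_nonneg {a b t : ℝ} (ha : 0 < a) (hb : 0 < b) (hbt : b ≤ t) :
    0 ≤ a / t ^ 2 * Real.log (t / b) :=
  mul_nonneg (by positivity) (Real.log_nonneg ((one_le_div hb).2 hbt))

lemma IsPosIncreasing.improper_log_div_iff {α β : ℝ → ℝ} (hα : IsPosIncreasing α)
    (hβ : IsPosIncreasing β) (hnq : NonQuasianalytic β) :
    ImproperIntegralEqTop 1 (fun t => α t / t ^ 2 * Real.log (t / β t)) ↔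
      ¬ IntegrableOn (fun t => α t / t ^ 2 * Real.log (t / β t)) (Ioi 1) := by
  obtain ⟨T, hT1, hT⟩ := hβ.eventually_le_self hnq
  exact ImproperIntegralEqTop.iff_not_integrableOn
    (fun R hR => hα.intervalIntegrable_log_div hβ hR) hT1 fun t ht =>
      div_sq_mul_log_div_nonneg (hα.1 t (by linarith)) (hβ.1 t (by linarith)) (hT t ht)

lemma IsPosIncreasing.improper_log_log_iff {α : ℝ → ℝ} (hα : IsPosIncreasing α) :
    ImproperIntegralEqTop (Real.exp 1) (fun t => α t / t ^ 2 * Real.log (Real.log t)) ↔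
      ¬ IntegrableOn (fun t => α t / t ^ 2 * Real.log (Real.log t)) (Ioi (Real.exp 1)) := by
  refine ImproperIntegralEqTop.iff_not_integrableOn
    (fun R hR => hα.intervalIntegrable_log_log hR) le_rfl fun t ht => ?_
  have h0 : 0 < t := (Real.exp_pos 1).trans_le ht
  have := hα.1 t h0
  exact mul_nonneg (by positivity) (Real.log_nonneg ((Real.le_log_iff_exp_le h0).2 ht))

/-! ### The double logarithm: the function `t / ln² t` and the bound `O(t / ln t)` -/

/-- The integrand is the derivative of `-1 / ln t`. It is left uncancelled to match `b / t²` with `b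
= t / ln² t`. -/
lemma integrableOn_inv_mul_sq_log :
    IntegrableOn (fun t : ℝ => t / Real.log t ^ 2 / t ^ 2) (Ioi (Real.exp 1)) := by
  have key : ∀ t, Real.exp 1 ≤ t → 0 < t ∧ 1 ≤ Real.log t := fun t ht =>
    have h0 : 0 < t := (Real.exp_pos 1).trans_le ht
    ⟨h0, (Real.le_log_iff_exp_le h0).2 ht⟩
  refine integrableOn_Ioi_deriv_of_nonneg' (g := fun t => -(Real.log t)⁻¹) (l := -0)
    (fun t ht => ?_) (fun t ht => ?_) (Real.tendsto_log_atTop.inv_tendsto_atTop.neg)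
  · obtain ⟨h0, h1⟩ := key t ht
    have hl : Real.log t ≠ 0 := by linarith
    refine ((Real.hasDerivAt_log h0.ne').inv hl).neg.congr_deriv ?_
    field_simp
  · obtain ⟨h0, h1⟩ := key t (le_of_lt ht)
    positivity

lemma IsPosIncreasing.improper_log_log_of_improper {α : ℝ → ℝ} (hα : IsPosIncreasing α)
    (hnq : NonQuasianalytic α)
    (h : ImproperIntegralEqTop 1 (fun t => α t / t ^ 2 * Real.log (t / α t))) :
    ImproperIntegralEqTop (Real.exp 1) (fun t => α t / t ^ 2 * Real.log (Real.log t)) := by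
  rw [hα.improper_log_log_iff]
  rw [hα.improper_log_div_iff hα hnq] at h
  intro hint
  obtain ⟨T, hT1, hT⟩ := hα.eventually_le_self hnq
  refine h (integrableOn_Ioi_of_eventually_le (T := max T (Real.exp 1))
    (fun R hR => hα.intervalIntegrable_log_div hα hR) (hT1.trans (le_max_left _ _))
    (fun t ht => ?_) (IntegrableOn.mono_set ((hint.const_mul 2).add integrableOn_inv_mul_sq_log)
      (Ioi_subset_Ioi (le_max_right T (Real.exp 1)))))
  have hTt := (le_max_left _ _).trans ht
  have het := (le_max_right _ _).trans ht
  have h0 : 0 < t := by linarith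
  have h1 : 1 ≤ Real.log t := (Real.le_log_iff_exp_le h0).2 het
  have hαt := hα.1 t h0
  refine ⟨div_sq_mul_log_div_nonneg hαt hαt (hT t hTt), ?_⟩
  -- The comparison is pointwise, so it does not matter that `t / ln² t` fails to be increasing near
  -- `e`.
  refine (div_sq_mul_log_div_le hαt (show 0 < t / Real.log t ^ 2 by positivity) h0).trans_eq ?_
  rw [div_div_cancel₀ h0.ne', Real.log_pow]
  simp only [Pi.add_apply]
  push_cast
  ring

/-- If `f (k s) ≤ C k f(s)` for all large `s` and all integers `k ≥ 1`, then
`f(t) = O(t / ln t)`. -/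
lemma IsPosIncreasing.le_div_log {α : ℝ → ℝ} (hα : IsPosIncreasing α)
    (hnq : NonQuasianalytic α) {C s₀ : ℝ}
    (h : ∀ s, s₀ ≤ s → ∀ k : ℕ, 1 ≤ k → α (k * s) ≤ C * k * α s) :
    ∃ D T, 0 < D ∧ Real.exp 1 ≤ T ∧ ∀ t, T ≤ t → α t ≤ D * (t / Real.log t) := by
  set a := max s₀ 1 with ha
  have ha1 : 1 ≤ a := le_max_right _ _
  have hC : 0 < C := by
    have h1 := h a (le_max_left _ _) 1 le_rfl
    have h2 := hα.1 a (by linarith)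
    simp only [Nat.cast_one, one_mul, mul_one] at h1
    nlinarith
  set I := ∫ t in Ioi 1, α t / t ^ 2 with hI
  have hI0 : 0 ≤ I := setIntegral_nonneg measurableSet_Ioi fun t ht => by
    have ht0 : 0 < t := one_pos.trans ht
    have := hα.1 t ht0
    positivity
  -- Taking `t ≥ a²` ensures `ln(t/a) ≥ (ln t)/2`; the `+ 1` keeps the constant positive.
  refine ⟨4 * C * I + 1, max (a ^ 2) (Real.exp 1), by positivity, le_max_right _ _,
    fun t ht => ?_⟩
  have hat : a ^ 2 ≤ t := (le_max_left _ _).trans ht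
  have hat' : a ≤ t := by nlinarith
  have ht0 : 0 < t := by linarith
  have hlog1 : 1 ≤ Real.log t := (Real.le_log_iff_exp_le ht0).2 ((le_max_right _ _).trans ht)
  have hαt := hα.1 t ht0
  -- Apply the growth bound with `k = ⌈t/s⌉`, which is at most `2t/s` because `t/s ≥ 1`.
  have hratio : ∀ s ∈ Icc a t, α t / (2 * C * t) * s⁻¹ ≤ α s / s ^ 2 := by
    intro s hs
    have hs1 : 1 ≤ s := ha1.trans hs.1
    have hs0 : 0 < s := by linarith
    have hts : 1 ≤ t / s := (one_le_div hs0).2 hs.2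
    have hk1 : 1 ≤ ⌈t / s⌉₊ := Nat.one_le_ceil_iff.2 (by linarith)
    have hk2 : (⌈t / s⌉₊ : ℝ) ≤ 2 * (t / s) := by
      linarith [Nat.ceil_lt_add_one (show 0 ≤ t / s by linarith)]
    have hk3 : t ≤ ⌈t / s⌉₊ * s := (div_le_iff₀ hs0).1 (Nat.le_ceil _)
    have hαs := hα.1 s hs0
    have h4 : α t ≤ C * (2 * (t / s)) * α s := by
      calc α t ≤ α (⌈t / s⌉₊ * s) := hα.2 ht0 (ht0.trans_le hk3) hk3
        _ ≤ C * ⌈t / s⌉₊ * α s := h s ((le_max_left _ _).trans hs.1) _ hk1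
        _ ≤ _ := by gcongr
    calc α t / (2 * C * t) * s⁻¹ ≤ C * (2 * (t / s)) * α s / (2 * C * t) * s⁻¹ := by gcongr
      _ = α s / s ^ 2 := by field_simp
  have hint : IntervalIntegrable (fun t => α t / t ^ 2) volume a t :=
    (intervalIntegrable_iff_integrableOn_Ioc_of_le hat').2
      (hnq.mono_set fun x hx => ha1.trans_lt hx.1)
  have h0not : (0 : ℝ) ∉ uIcc a t := by
    rw [uIcc_of_le hat']
    intro h0
    linarith [h0.1]
  have h5 : (∫ s in a..t, α t / (2 * C * t) * s⁻¹) ≤ ∫ s in a..t, α s / s ^ 2 :=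
    intervalIntegral.integral_mono_on hat'
      ((intervalIntegral.intervalIntegrable_inv (fun s hs => fun h => h0not (h ▸ hs))
        continuousOn_id).const_mul _) hint hratio
  rw [intervalIntegral.integral_const_mul, integral_inv h0not,
    Real.log_div ht0.ne' (by linarith), intervalIntegral.integral_of_le hat'] at h5
  have h6 : (∫ s in Ioc a t, α s / s ^ 2) ≤ I := by
    refine setIntegral_mono_set hnq ?_ (Eventually.of_forall fun x hx => ha1.trans_lt hx.1)
    filter_upwards [ae_restrict_mem measurableSet_Ioi] with x hx
    have hx0 : 0 < x := one_pos.trans hx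
    have := hα.1 x hx0
    simp only [Pi.zero_apply]
    positivity
  have h7 : Real.log a ≤ Real.log t / 2 := by
    have := Real.log_le_log (by positivity) hat
    rw [Real.log_pow] at this
    push_cast at this
    linarith
  have h8 : α t / (2 * C * t) * (Real.log t / 2) ≤ I := by
    refine le_trans ?_ (h5.trans h6)
    gcongr
    linarith
  have h9 : α t * Real.log t ≤ 4 * C * I * t := by
    calc α t * Real.log t = α t / (2 * C * t) * (Real.log t / 2) * (4 * C * t) := by
          field_simp
          ring
      _ ≤ I * (4 * C * t) := by gcongr
      _ = _ := by ring
  rw [← mul_div_assoc, le_div_iff₀ (by linarith)]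
  linarith

lemma IsPosIncreasing.not_integrableOn_of_improper_log_log {α : ℝ → ℝ}
    (hα : IsPosIncreasing α) (hnq : NonQuasianalytic α) {C s₀ : ℝ}
    (h : ∀ s, s₀ ≤ s → ∀ k : ℕ, 1 ≤ k → α (k * s) ≤ C * k * α s)
    (h3 : ImproperIntegralEqTop (Real.exp 1) (fun t => α t / t ^ 2 * Real.log (Real.log t))) :
    ¬ IntegrableOn (fun t => α t / t ^ 2 * Real.log (t / α t)) (Ioi 1) := by
  intro hint
  obtain ⟨D, T, hD, heT, hT⟩ := hα.le_div_log hnq h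
  refine hα.improper_log_log_iff.1 h3 (integrableOn_Ioi_of_eventually_le (T := T)
    (fun R hR => hα.intervalIntegrable_log_log hR) heT (fun t ht => ?_)
    ((hint.add (hnq.const_mul (Real.log D))).mono_set
      (Ioi_subset_Ioi ((Real.one_le_exp zero_le_one).trans heT))))
  have h0 : 0 < t := (Real.exp_pos 1).trans_le (heT.trans ht)
  have h1 : 1 ≤ Real.log t := (Real.le_log_iff_exp_le h0).2 (heT.trans ht)
  have hαt := hα.1 t h0
  refine ⟨mul_nonneg (by positivity) (Real.log_nonneg h1), ?_⟩
  have h4 : Real.log t ≤ D * (t / α t) := by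
    have := hT t ht
    rw [← mul_div_assoc, le_div_iff₀ (by linarith)] at this
    rw [← mul_div_assoc, le_div_iff₀ hαt]
    linarith
  have h5 : Real.log (Real.log t) ≤ Real.log D + Real.log (t / α t) := by
    rw [← Real.log_mul hD.ne' (by positivity)]
    exact Real.log_le_log (by linarith) h4
  calc α t / t ^ 2 * Real.log (Real.log t)
      ≤ α t / t ^ 2 * (Real.log D + Real.log (t / α t)) := by gcongr
    _ = _ := by
      simp only [Pi.add_apply]
      ring

lemma IsSubadditiveOnPos.nat_mul_le {α : ℝ → ℝ} (h : IsSubadditiveOnPos α) {s : ℝ}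
    (hs : 0 < s) {k : ℕ} (hk : 1 ≤ k) : α (k * s) ≤ k * α s := by
  induction k, hk using Nat.le_induction with
  | base => simp
  | succ n hn ih =>
    have hn0 : (0 : ℝ) < n := by exact_mod_cast hn
    push_cast
    rw [add_mul, one_mul, add_mul, one_mul]
    linarith [h (n * s) s (by positivity) hs]

/-! ### Growth of canonical products -/

/-- The sum is `ln(k^k / k!)`, and `k^k / k!` is a single term of the series for `e^k`. -/
lemma sum_log_div_le (k : ℕ) :
    ∑ j ∈ Finset.range k, Real.log ((k : ℝ) / ((j : ℝ) + 1)) ≤ k := by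
  rcases Nat.eq_zero_or_pos k with rfl | hk
  · simp
  have hk0 : (0 : ℝ) < k := by exact_mod_cast hk
  rw [← Real.log_prod fun j _ => by positivity, Finset.prod_div_distrib, Finset.prod_const,
    Finset.card_range]
  have : ∏ j ∈ Finset.range k, ((j : ℝ) + 1) = (k.factorial : ℝ) := by
    rw [← Finset.prod_range_add_one_eq_factorial]
    push_cast
    rfl
  rw [this, Real.log_le_iff_le_exp (by positivity)]
  exact Real.pow_div_factorial_le_exp _ hk0.le k

lemma log_norm_one_add_I_mul (x : ℝ) :
    Real.log ‖(1 : ℂ) + Complex.I * x‖ = Real.log (1 + x ^ 2) / 2 := by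
  have : (1 : ℂ) + Complex.I * x = ((1 : ℝ) : ℂ) + (x : ℂ) * Complex.I := by
    push_cast
    ring
  rw [this, Complex.norm_add_mul_I, Real.log_sqrt (by positivity)]
  simp

lemma log_one_add_sq_mul_le {c y : ℝ} (hc : 1 ≤ c) :
    Real.log (1 + (c * y) ^ 2) / 2 ≤ Real.log c + Real.log (1 + y ^ 2) / 2 := by
  have h1 : Real.log (1 + (c * y) ^ 2) ≤ Real.log (c ^ 2 * (1 + y ^ 2)) := by
    refine Real.log_le_log (by positivity) ?_
    nlinarith
  rw [Real.log_mul (by positivity) (by positivity), Real.log_pow] at h1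
  push_cast at h1
  linarith

lemma log_one_add_sq_mono {x y : ℝ} (hx : 0 ≤ x) (hxy : x ≤ y) :
    Real.log (1 + x ^ 2) / 2 ≤ Real.log (1 + y ^ 2) / 2 := by
  gcongr

/-- The growth bound for the canonical products: if `(j + 1) u_j` decreases, then
`g(s) = ∑ ln (1 + (s u_j)²) / 2` satisfies `g(k s) ≤ 5 k g(s)` as soon as `s u_0 ≥ 1`. -/
lemma hasSum_log_one_add_sq_nat_mul_le {u : ℕ → ℝ} (hu0 : ∀ j, 0 ≤ u j)
    (hu : Antitone fun j : ℕ => ((j : ℝ) + 1) * u j) {s A B : ℝ} (hs : 0 < s)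
    (hsu : 1 ≤ s * u 0) {k : ℕ} (hk : 1 ≤ k)
    (hA : HasSum (fun j => Real.log (1 + (s * u j) ^ 2) / 2) A)
    (hB : HasSum (fun j => Real.log (1 + (k * s * u j) ^ 2) / 2) B) :
    B ≤ 5 * k * A := by
  set f : ℝ → ℝ := fun x => Real.log (1 + x ^ 2) / 2 with hf
  have hk0 : (1 : ℝ) ≤ k := by exact_mod_cast hk
  have hf0 : ∀ x, 0 ≤ f x := fun x => by
    have := Real.log_nonneg (show 1 ≤ 1 + x ^ 2 by nlinarith [sq_nonneg x])
    simp only [hf]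
    linarith
  have hA0 : f (s * u 0) ≤ A := le_hasSum hA 0 fun j _ => hf0 _
  -- `(ln 2)/2 > 1/3`; this lets the additive error `k` below be absorbed into `3kA`.
  have hA1 : 1 ≤ 3 * A := by
    have h1 : f 1 ≤ f (s * u 0) := log_one_add_sq_mono zero_le_one hsu
    have h2 : f 1 = Real.log 2 / 2 := by simp only [hf]; norm_num
    linarith [Real.log_two_gt_d9]
  -- For `j < k`, `u_j ≤ u_0/(j+1)`, so each term costs at most `ln(k/(j+1))` more than the zeroth
  -- term of `A`.
  have hhead : ∑ j ∈ Finset.range k, f (k * s * u j) ≤ 4 * k * A := by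
    calc ∑ j ∈ Finset.range k, f (k * s * u j)
        ≤ ∑ j ∈ Finset.range k, (Real.log ((k : ℝ) / ((j : ℝ) + 1)) + A) := by
          refine Finset.sum_le_sum fun j hj => ?_
          have hj1 : (j : ℝ) + 1 ≤ k := by exact_mod_cast Finset.mem_range.1 hj
          have hj0 : (0 : ℝ) < (j : ℝ) + 1 := by positivity
          have h1 : ((j : ℝ) + 1) * u j ≤ u 0 := by simpa using hu (Nat.zero_le j)
          have h2 : u j ≤ u 0 / ((j : ℝ) + 1) := by
            rw [le_div_iff₀ hj0]
            linarith
          have h3 : k * s * u j ≤ (k / ((j : ℝ) + 1)) * (s * u 0) := by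
            calc k * s * u j ≤ k * s * (u 0 / ((j : ℝ) + 1)) := by gcongr
              _ = _ := by ring
          have h4 : f (k * s * u j) ≤ f ((k / ((j : ℝ) + 1)) * (s * u 0)) :=
            log_one_add_sq_mono (by have := hu0 j; positivity) h3
          have h5 : f ((k / ((j : ℝ) + 1)) * (s * u 0)) ≤ _ + f (s * u 0) :=
            log_one_add_sq_mul_le ((one_le_div hj0).2 hj1)
          linarith
      _ ≤ k + k * A := by
          rw [Finset.sum_add_distrib, Finset.sum_const, Finset.card_range, nsmul_eq_mul]
          linarith [sum_log_div_le k]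
      _ ≤ 4 * k * A := by nlinarith
  -- Indices from `k` on are split into blocks of length `k`. In block `M` every index `j` has `j +
  -- 1 ≥ k(M+1)`, so `k u_j ≤ u_M` and the whole block is bounded by `k` copies of term `M` of `A`.
  have htail : ∀ M : ℕ, ∑ j ∈ Finset.range (k + k * M), f (k * s * u j) ≤
      4 * k * A + k * ∑ m ∈ Finset.range M, f (s * u m) := by
    intro M
    induction M with
    | zero => simpa using hhead
    | succ M ih =>
      have hblock : ∑ r ∈ Finset.range k, f (k * s * u (k + k * M + r)) ≤ k * f (s * u M) := by
        calc _ ≤ ∑ r ∈ Finset.range k, f (s * u M) := by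
              refine Finset.sum_le_sum fun r _ => log_one_add_sq_mono
                (by have := hu0 (k + k * M + r); positivity) ?_
              have h1 : M ≤ k + k * M + r := by nlinarith
              have h2 := hu h1
              simp only at h2
              push_cast at h2
              have h3 : (k * ((M : ℝ) + 1)) * u (k + k * M + r) ≤ ((M : ℝ) + 1) * u M := by
                refine le_trans (mul_le_mul_of_nonneg_right ?_ (hu0 _)) h2
                have : (0 : ℝ) ≤ r := by positivity
                linarith
              have h4 : k * u (k + k * M + r) ≤ u M := by
                have hM : (0 : ℝ) < (M : ℝ) + 1 := by positivity
                refine le_of_mul_le_mul_left ?_ hM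
                linarith
              calc k * s * u (k + k * M + r) = s * (k * u (k + k * M + r)) := by ring
                _ ≤ s * u M := by gcongr
          _ = _ := by simp
      rw [show k + k * (M + 1) = k + k * M + k by ring, Finset.sum_range_add,
        Finset.sum_range_succ, mul_add]
      linarith
  have hlim : Tendsto (fun M : ℕ => ∑ j ∈ Finset.range (k + k * M), f (k * s * u j)) atTop
      (𝓝 B) := by
    refine hB.tendsto_sum_nat.comp (tendsto_atTop_mono (fun M => ?_) tendsto_id)
    simp only [id]
    nlinarith
  refine le_of_tendsto hlim (Eventually.of_forall fun M => (htail M).trans ?_)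
  have h1 : ∑ m ∈ Finset.range M, f (s * u m) ≤ A := sum_le_hasSum _ (fun j _ => hf0 _) hA
  nlinarith

lemma OmegaZero.exists_nat_mul_le {α : ℝ → ℝ} (hα : ∀ t, 0 < t → 0 < α t) {w : ℂ → ℂ}
    (hw : w ∈ OmegaZero) (h : ∀ t : ℝ, 0 < t → α t = Real.log ‖w (t : ℂ)‖) :
    ∃ s₀, ∀ s, s₀ ≤ s → ∀ k : ℕ, 1 ≤ k → α (k * s) ≤ 5 * k * α s := by
  obtain ⟨t, ht0, ht1, hmono, -, hprod⟩ := hw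
  set u : ℕ → ℝ := fun j => (t j)⁻¹.toReal with hu
  have hu0 : ∀ j, 0 ≤ u j := fun j => ENNReal.toReal_nonneg
  have hupos : 0 < u 0 := ENNReal.toReal_pos (by simpa using ht1.ne) (by simpa using ht0.ne')
  have hanti : Antitone fun j : ℕ => ((j : ℝ) + 1) * u j := by
    intro m j hmj
    -- Passing to reciprocals turns `t_j = +∞` into `u_j = 0`, so infinite `t_j` need no separate
    -- treatment.
    have hinv : ∀ i : ℕ, ((i : ℝ) + 1) * u i = ((t i / ((i : ENNReal) + 1))⁻¹).toReal := by
      intro i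
      rw [ENNReal.inv_div (Or.inl (by finiteness)) (Or.inl (by positivity)), div_eq_mul_inv,
        ENNReal.toReal_mul]
      congr 1
    simp only [hinv]
    refine ENNReal.toReal_mono ?_ (ENNReal.inv_le_inv.2 (hmono hmj))
    refine ENNReal.inv_ne_top.2 (ne_of_gt ?_)
    refine lt_of_lt_of_le ?_ (hmono (Nat.zero_le m))
    simpa using ht0
  have hsum : ∀ s : ℝ, 0 < s → HasSum (fun j => Real.log (1 + (s * u j) ^ 2) / 2) (α s) := by
    intro s hs
    -- Since `Real.log 0 = 0`, positivity of `α` excludes a zero of `w`; the logarithm is then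
    -- continuous there and turns the product into a sum.
    have hw0 : ‖w (s : ℂ)‖ ≠ 0 := by
      intro h0
      have := hα s hs
      rw [h s hs, h0, Real.log_zero] at this
      exact lt_irrefl _ this
    have h1 := (Real.continuousAt_log hw0).tendsto.comp (hprod (s : ℂ)).norm
    rw [← h s hs] at h1
    refine h1.congr fun F => ?_
    simp only [Function.comp_apply]
    have h2 : ∀ j, (1 : ℂ) + Complex.I * s * ((u j : ℝ) : ℂ) =
        1 + Complex.I * ((s * u j : ℝ) : ℂ) := fun j => by
      push_cast
      ring
    rw [Real.log_prod]
    · exact Finset.sum_congr rfl fun j _ => by rw [h2, log_norm_one_add_I_mul]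
    · intro j _ h0
      rw [h2, norm_eq_zero] at h0
      have := congrArg Complex.re h0
      simp at this
  -- This threshold is exactly the condition `s u_0 ≥ 1`.
  refine ⟨(u 0)⁻¹, fun s hs k hk => ?_⟩
  have hs0 : 0 < s := (inv_pos.2 hupos).trans_le hs
  have hk0 : (0 : ℝ) < k := by exact_mod_cast hk
  exact hasSum_log_one_add_sq_nat_mul_le hu0 hanti hs0
    ((inv_le_iff_one_le_mul₀ hupos).1 hs) hk (hsum s hs0) (hsum (k * s) (by positivity))

theorem proposition5p2 (α : ℝ → ℝ) (hα : IsPosIncreasing α) (hnq : NonQuasianalytic α) :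
    -- (i) in its two forms, and (ii), are equivalent
    List.TFAE
      [¬ MildStrongNonQuasianalytic α,
        ImproperIntegralEqTop 1 (fun t => α t / t ^ 2 * Real.log (t / α t)),
        ∀ β : ℝ → ℝ, IsPosIncreasing β → NonQuasianalytic β →
          ImproperIntegralEqTop 1 (fun t => α t / t ^ 2 * Real.log (t / β t))] ∧
    -- they imply (iii)
    (ImproperIntegralEqTop 1 (fun t => α t / t ^ 2 * Real.log (t / α t)) →
      ImproperIntegralEqTop (Real.exp 1) (fun t => α t / t ^ 2 * Real.log (Real.log t))) ∧
    -- and all are equivalent in the two special cases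
    ((IsSubadditiveOnPos α ∨
        ∃ w ∈ OmegaZero, ∀ t : ℝ, 0 < t → α t = Real.log ‖w (t : ℂ)‖) →
      List.TFAE
        [¬ MildStrongNonQuasianalytic α,
          ImproperIntegralEqTop 1 (fun t => α t / t ^ 2 * Real.log (t / α t)),
          ∀ β : ℝ → ℝ, IsPosIncreasing β → NonQuasianalytic β →
            ImproperIntegralEqTop 1 (fun t => α t / t ^ 2 * Real.log (t / β t)),
          ImproperIntegralEqTop (Real.exp 1)
            (fun t => α t / t ^ 2 * Real.log (Real.log t))]) := by
  have h12 : ¬ MildStrongNonQuasianalytic α ↔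
      ImproperIntegralEqTop 1 (fun t => α t / t ^ 2 * Real.log (t / α t)) := by
    rw [hα.improper_log_div_iff hα hnq, MildStrongNonQuasianalytic]
    simp [hnq]
  have h23 : ImproperIntegralEqTop 1 (fun t => α t / t ^ 2 * Real.log (t / α t)) ↔
      ∀ β : ℝ → ℝ, IsPosIncreasing β → NonQuasianalytic β →
        ImproperIntegralEqTop 1 (fun t => α t / t ^ 2 * Real.log (t / β t)) := by
    refine ⟨fun h β hβ hβnq => ?_, fun h => h α hα hnq⟩
    rw [hα.improper_log_div_iff hα hnq] at h
    rw [hα.improper_log_div_iff hβ hβnq]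
    intro hint
    obtain ⟨T, hT1, hT⟩ := hα.eventually_le_self hnq
    refine h (integrableOn_Ioi_of_eventually_le
      (fun R hR => hα.intervalIntegrable_log_div hα hR) hT1 (fun t ht => ?_)
      ((hint.add hβnq).mono_set (Ioi_subset_Ioi hT1)))
    have h0 : 0 < t := by linarith
    exact ⟨div_sq_mul_log_div_nonneg (hα.1 t h0) (hα.1 t h0) (hT t ht),
      div_sq_mul_log_div_le (hα.1 t h0) (hβ.1 t h0) h0⟩
  have h24 := hα.improper_log_log_of_improper hnq
  refine ⟨?_, h24, fun hspecial => ?_⟩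
  · tfae_have 1 ↔ 2 := h12
    tfae_have 2 ↔ 3 := h23
    tfae_finish
  · have hgrowth : ∃ C s₀ : ℝ, ∀ s, s₀ ≤ s → ∀ k : ℕ, 1 ≤ k → α (k * s) ≤ C * k * α s := by
      rcases hspecial with hsub | ⟨w, hw, hαw⟩
      · refine ⟨1, 1, fun s hs k hk => ?_⟩
        rw [one_mul]
        exact hsub.nat_mul_le (by linarith) hk
      · exact ⟨5, OmegaZero.exists_nat_mul_le hα.1 hw hαw⟩
    obtain ⟨C, s₀, hC⟩ := hgrowth
    tfae_have 1 ↔ 2 := h12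
    tfae_have 2 ↔ 3 := h23
    tfae_have 2 → 4 := h24
    tfae_have 4 → 2 := fun h4 => (hα.improper_log_div_iff hα hnq).2
      (hα.not_integrableOn_of_improper_log_log hnq hC h4)
    tfae_finish
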